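/- For $r\ge 1$ let $\mathcal A_r$ be the class of $(r-1)$-times continuously differentiable functions $\varphi:\mathbb R\to\mathbb C$ for which there are $\epsilon,C>0$ with $$|\varphi^{(s)}(t)|\le C(1+|t|)^{-1-\epsilon}\quad\text{and}\quad |\widehat{\varphi^{(s)}}(\omega)|\le C(1+|\omega|)^{-1-\epsilon}\qquad (t,\omega\in\mathbb R,\ 0\le s\le r-1),$$ where $\widehat f(\omega)=\int_{\mathbb R} f(t)e^{-2\pi i\omega t}\,dt$. Let $V(\varphi)=\{\sum_{k\in\mathbb Z}d_k\varphi(\cdot-k):(d_k)\in\ell^2(\mathbb Z)\}\subset L^2(\mathbb R)$, with convergence in $L^2(\mathbb R)$. The function $\varphi$ is a stable generator if $\{\varphi(\cdot-k):k\in\mathbb Z\}$ is a Riesz basis for $V(\varphi)$, i.e. the closed linear span of these translates is $V(\varphi)$ and there are $A,B>0$ with $A\sum_k|d_k|^2\le\|\sum_k d_k\varphi(\cdot-k)\|_2^2\le B\sum_k|d_k|^2$ for all $(d_k)\in\ell^2(\mathbb Z)$. If $\varphi\in\mathcal A_r$ is a stable generator, every $f\in V(\varphi)$ is identified with its representative of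 class $C^{r-1}$. A set $\Gamma\subset\mathbb R$ is a complete interpolation set (CIS) of order $r-1$ for $V(\varphi)$ if 1. there are $A,B>0$ such that $A\|f\|_2^2\le\sum_{y\in\Gamma}\sum_{i=0}^{r-1}|f^{(i)}(y)|^2\le B\|f\|_2^2$ for all $f\in V(\varphi)$, and 2. for every square summable family $(c_{y,i})_{y\in\Gamma,\,0\le i\le r-1}$ of complex numbers there is $f\in V(\varphi)$ with $f^{(i)}(y)=c_{y,i}$ for all $y\in\Gamma$ and $0\le i\le r-1$. The Zak transform of $\varphi$ is $\mathcal Z\varphi(t,\omega)=\sum_{k\in\mathbb Z}\varphi(t-k)e^{2\pi i k\omega}$. **Theorem.** Let $r,L\ge 1$ be integers, let $\rho=Lr$, let $\varphi\in\mathcal A_r$ be a stable generator for $V(\varphi)$, let $x_0,\dots,x_{L-1}\in\mathbb R$, and let $X=\{x_n+\rho l:0\le n\le L-1,\ l\in\mathbb Z\}$ be the corresponding periodic nonuniform sampling set of period $\rho$ and length $L$. For $0\le i,j\le\rho-1$ put $d_i=i\bmod r$, $t_i=x_{\lfloor i/r\rfloor}$ and $u_j(t;x)=\mathcal Z\varphi\left(t,\frac{-x+j}{\rho}\right)$.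 Then $X$ is a CIS of order $r-1$ for $V(\varphi)$ if and only if $$\det\left[D^{d_i}u_j(t_i;x)\right]_{i,j=0}^{\rho-1}\ne 0\quad\text{for all }x\in[0,1],\qquad D^p=\frac{\partial^p}{\partial t^p}.$$ -/

import Mathlib

open MeasureTheory Filter Topology
open scoped FourierTransform

noncomputable section

/-- The Hilbert space `L²(ℝ)` of complex-valued functions. -/
abbrev L2R : Type := Lp ℂ 2 (volume : Measure ℝ)

/-- The integer translate `φ(· - k)` as an element of `L²(ℝ)`. -/
def shiftL2 (φ : ℝ → ℂ) (hφ : MemLp φ 2 volume) (k : ℤ) : L2R :=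
  (hφ.comp_measurePreserving (measurePreserving_sub_right volume (k : ℝ))).toLp
    (φ ∘ fun t : ℝ => t - (k : ℝ))

/-- The shift-invariant space `V(φ)`: all `f ∈ L²(ℝ)` of the form `∑ₖ dₖ φ(· - k)` with
`(dₖ) ∈ ℓ²(ℤ)`, the series converging in `L²(ℝ)`. -/
def shiftInvariantSpace (φ : ℝ → ℂ) (hφ : MemLp φ 2 volume) : Set L2R :=
  {f | ∃ d : ℤ → ℂ, Summable (fun k => ‖d k‖ ^ 2) ∧ HasSum (fun k => d k • shiftL2 φ hφ k) f}

/-- `φ` is a stable generator for `V(φ)`: its integer translates form a Riesz basis of `V(φ)`. -/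
def IsStableGenerator (φ : ℝ → ℂ) (hφ : MemLp φ 2 volume) : Prop :=
  closure (Submodule.span ℂ (Set.range (shiftL2 φ hφ)) : Set L2R) = shiftInvariantSpace φ hφ ∧
  ∃ A B : ℝ, 0 < A ∧ 0 < B ∧
    ∀ d : ℤ → ℂ, Summable (fun k => ‖d k‖ ^ 2) →
      Summable (fun k => d k • shiftL2 φ hφ k) ∧
      A * ∑' k, ‖d k‖ ^ 2 ≤ ‖∑' k, d k • shiftL2 φ hφ k‖ ^ 2 ∧
      ‖∑' k, d k • shiftL2 φ hφ k‖ ^ 2 ≤ B * ∑' k, ‖d k‖ ^ 2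

/-- The class `𝒜_r` (for `r ≥ 1`): `φ` is `r - 1` times continuously differentiable, and all
derivatives up to order `r - 1` and their Fourier transforms decay like `(1 + |·|)^(-1-ε)`. -/
def ClassA (r : ℕ) (φ : ℝ → ℂ) : Prop :=
  ContDiff ℝ ((r - 1 : ℕ) : WithTop ℕ∞) φ ∧
  ∃ ε C : ℝ, 0 < ε ∧ 0 < C ∧ ∀ s : ℕ, s < r →
    (∀ t : ℝ, ‖iteratedDeriv s φ t‖ ≤ C * (1 + |t|) ^ (-1 - ε)) ∧
    (∀ w : ℝ, ‖𝓕 (iteratedDeriv s φ) w‖ ≤ C * (1 + |w|) ^ (-1 - ε))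

/-- `g` is the (unique, if it exists) representative of class `C^m` of `f ∈ L²(ℝ)`. Samples of the
elements of `V(φ)` and of their derivatives are those of this representative. -/
def IsRegularRep (m : ℕ) (f : L2R) (g : ℝ → ℂ) : Prop :=
  ContDiff ℝ (m : WithTop ℕ∞) g ∧ g =ᵐ[volume] f

/-- `Γ` is a set of stable sampling of order `m` for `V(φ)`. -/
def IsStableSampling (φ : ℝ → ℂ) (hφ : MemLp φ 2 volume) (m : ℕ) (Γ : Set ℝ) : Prop :=
  ∃ A B : ℝ, 0 < A ∧ 0 < B ∧
    ∀ f ∈ shiftInvariantSpace φ hφ, ∃ g : ℝ → ℂ, IsRegularRep m f g ∧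
      Summable (fun y : Γ => ∑ i ∈ Finset.range (m + 1), ‖iteratedDeriv i g y‖ ^ 2) ∧
      A * ‖f‖ ^ 2 ≤ ∑' y : Γ, ∑ i ∈ Finset.range (m + 1), ‖iteratedDeriv i g y‖ ^ 2 ∧
      ∑' y : Γ, ∑ i ∈ Finset.range (m + 1), ‖iteratedDeriv i g y‖ ^ 2 ≤ B * ‖f‖ ^ 2

/-- `Γ` is a set of interpolation of order `m` for `V(φ)`. -/
def IsInterpolationSet (φ : ℝ → ℂ) (hφ : MemLp φ 2 volume) (m : ℕ) (Γ : Set ℝ) : Prop :=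
  ∀ c : Γ → Fin (m + 1) → ℂ, Summable (fun y : Γ => ∑ i, ‖c y i‖ ^ 2) →
    ∃ f ∈ shiftInvariantSpace φ hφ, ∃ g : ℝ → ℂ, IsRegularRep m f g ∧
      ∀ (y : Γ) (i : Fin (m + 1)), iteratedDeriv i g y = c y i

/-- `Γ` is a complete interpolation set (CIS) of order `m` for `V(φ)`. -/
def IsCIS (φ : ℝ → ℂ) (hφ : MemLp φ 2 volume) (m : ℕ) (Γ : Set ℝ) : Prop :=
  IsStableSampling φ hφ m Γ ∧ IsInterpolationSet φ hφ m Γ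

/-- The periodic nonuniform sampling set `{xₙ + ρ l : 0 ≤ n ≤ L - 1, l ∈ ℤ}`. -/
def pnsSet {L : ℕ} (ρ : ℝ) (x : Fin L → ℝ) : Set ℝ :=
  {y | ∃ (n : Fin L) (l : ℤ), y = x n + ρ * l}

/-- The Zak transform `𝒵_α f(x, y) = ∑ₖ f(x - α k) e^{2πi α k y}`. -/
def zak (α : ℝ) (f : ℝ → ℂ) (x y : ℝ) : ℂ :=
  ∑' k : ℤ, f (x - α * k) * Complex.exp (2 * Real.pi * Complex.I * (α * k * y))

/-- `u_j(t; y) = 𝒵φ(t, (-y + j)/ρ)`, with `𝒵 = 𝒵₁`. -/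
def zakU (φ : ℝ → ℂ) (ρ j : ℕ) (t y : ℝ) : ℂ :=
  zak 1 φ t ((-y + j) / ρ)

/-- The matrix `[D^{d_i} u_j(t_i; y)]`, `0 ≤ i, j ≤ ρ - 1`, with `d_i = i mod r`,
`t_i = x_{⌊i/r⌋}` and `D = ∂/∂t`. -/
def zakMatrix (φ : ℝ → ℂ) {L r ρ : ℕ} (hρ : ρ = L * r) (x : Fin L → ℝ) (y : ℝ) :
    Matrix (Fin ρ) (Fin ρ) ℂ :=
  Matrix.of fun i j =>
    iteratedDeriv ((i : ℕ) % r) (fun t => zakU φ ρ j t y) (x (Fin.cast hρ i).divNat)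

end

/-! Split the coefficients `d` of `f = ∑ₖ dₖ φ(· - k)` into residue classes modulo `ρ` and read each
class as the Fourier coefficients of some `F s` in `L²(ℝ/ℤ)`. Since `X` is `ρ`-periodic, sampling
`f` and its derivatives is a convolution in each class, so it becomes multiplication of the vector
`F` by a square matrix of functions on the circle, the symbol (`fourierCoeff_pnsSymbol`). Decay of
`φ` makes its entries absolutely convergent Fourier series, hence continuous. By Parseval and the
Riesz bounds, `‖f‖²` is comparable to `∑ ‖F s‖²`, and the sample energy is the squared norm of the
image (`hasSum_sq_samples`).

The Zak matrix is the symbol times an invertible Vandermonde matrix (`zakMatrix_eq`), so the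
determinant condition says that the symbol is invertible at every point. Then its inverse is again a
continuous matrix, which yields both stability and interpolation. If instead the symbol is singular
at some point, a kernel vector times a function concentrated there has relatively tiny samples
(`exists_symbolOp_small`), contradicting the lower sampling bound. -/

noncomputable section

/-! ### Multiplication operators and Fourier coefficients on the circle -/

/-- The Hilbert space `L²(ℝ/ℤ)`. -/
abbrev L2Circle : Type := Lp ℂ 2 (AddCircle.haarAddCircle : Measure UnitAddCircle)

/-- Multiplication of square integrable functions on the circle by continuous functions. -/
def circleMul : C(UnitAddCircle, ℂ) →L[ℂ] L2Circle →L[ℂ] L2Circle :=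
  ((ContinuousLinearMap.mul ℂ ℂ).holderL AddCircle.haarAddCircle ⊤ 2 2) ∘L
    (ContinuousMap.toLp ⊤ AddCircle.haarAddCircle ℂ)

lemma coeFn_circleMul (ψ : C(UnitAddCircle, ℂ)) (F : L2Circle) :
    circleMul ψ F =ᵐ[AddCircle.haarAddCircle] fun t => ψ t * F t := by
  have h1 : circleMul ψ F = (ContinuousLinearMap.mul ℂ ℂ).holder 2
    (ContinuousMap.toLp ⊤ AddCircle.haarAddCircle ℂ ψ) F := rfl
  rw [h1]
  filter_upwards [(ContinuousLinearMap.mul ℂ ℂ).coeFn_holder (r := 2)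
      (ContinuousMap.toLp ⊤ AddCircle.haarAddCircle ℂ ψ) F,
    ContinuousMap.coeFn_toLp (p := ⊤) (𝕜 := ℂ) AddCircle.haarAddCircle ψ] with t h2 h3
  rw [h2, h3]
  rfl

lemma circleMul_one (F : L2Circle) : circleMul 1 F = F := by
  apply Lp.ext
  filter_upwards [coeFn_circleMul 1 F] with t ht
  simp [ht]

lemma circleMul_mul (ψ χ : C(UnitAddCircle, ℂ)) (F : L2Circle) :
    circleMul (ψ * χ) F = circleMul ψ (circleMul χ F) := by
  apply Lp.ext
  filter_upwards [coeFn_circleMul (ψ * χ) F, coeFn_circleMul ψ (circleMul χ F),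
    coeFn_circleMul χ F] with t h1 h2 h3
  simp [h1, h2, h3, mul_assoc]

/-- The `n`-th Fourier coefficient as a continuous linear functional on `L²(ℝ/ℤ)`. -/
def fourierCoeffCLM (n : ℤ) : L2Circle →L[ℂ] ℂ :=
  innerSL ℂ (fourierBasis n)

lemma fourierCoeffCLM_apply (n : ℤ) (F : L2Circle) :
    fourierCoeffCLM n F = fourierCoeff F n := by
  rw [← fourierBasis_repr, HilbertBasis.repr_apply_apply]
  rfl

lemma fourierCoeff_circleMul_fourier (n l : ℤ) (F : L2Circle) :
    fourierCoeff (circleMul (fourier n) F) l = fourierCoeff F (l - n) := by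
  rw [fourierCoeff_congr_ae (coeFn_circleMul (fourier n) F)]
  unfold fourierCoeff
  refine integral_congr_ae (Eventually.of_forall fun t => ?_)
  simp only [smul_eq_mul]
  rw [← mul_assoc, ← fourier_add, show -l + n = -(l - n) by ring]

/-- The continuous function on the circle with prescribed (summable) Fourier coefficients. -/
def trigSeries (a : ℤ → ℂ) : C(UnitAddCircle, ℂ) := ∑' n, a n • fourier n

lemma hasSum_trigSeries {a : ℤ → ℂ} (ha : Summable a) :
    HasSum (fun n => a n • (fourier n : C(UnitAddCircle, ℂ))) (trigSeries a) := by
  apply Summable.hasSum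
  apply Summable.of_norm
  simpa [norm_smul, fourier_norm] using ha.norm

/-- Multiplication by a trigonometric series is convolution of the coefficients. -/
lemma fourierCoeff_circleMul_trigSeries {a : ℤ → ℂ} (ha : Summable a) (F : L2Circle) (l : ℤ) :
    HasSum (fun n => a n * fourierCoeff F (l - n))
      (fourierCoeff (circleMul (trigSeries a) F) l) := by
  have := (hasSum_trigSeries ha).map ((fourierCoeffCLM l) ∘L (circleMul.flip F)) (by fun_prop)
  simpa [Function.comp_def, fourierCoeffCLM_apply, fourierCoeff_circleMul_fourier] using this

lemma hasSum_sq_fourierCoeff_L2 (F : L2Circle) :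
    HasSum (fun n => ‖fourierCoeff F n‖ ^ 2) (‖F‖ ^ 2) := by
  have h := lp.hasSum_norm (p := 2) (by norm_num) (fourierBasis.repr F)
  simp only [LinearIsometryEquiv.norm_map, fourierBasis_repr] at h
  norm_num at h
  exact_mod_cast h

lemma exists_fourierCoeff_eq {c : ℤ → ℂ} (hc : Summable fun n => ‖c n‖ ^ 2) :
    ∃ F : L2Circle, ∀ n, fourierCoeff F n = c n := by
  have hm : Memℓp c 2 := by
    apply memℓp_gen
    norm_num
    exact_mod_cast hc
  refine ⟨fourierBasis.repr.symm ⟨c, hm⟩, fun n => ?_⟩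
  rw [← fourierBasis_repr]
  simp

/-- Near a common zero of finitely many continuous functions one can localise a nonzero element
of `L²(ℝ/ℤ)` on which all of them act with small norm. -/
lemma exists_norm_circleMul_le {ι : Type*} [Finite ι] (ψ : ι → C(UnitAddCircle, ℂ))
    (y : UnitAddCircle) (hψ : ∀ i, ψ i y = 0) {ε : ℝ} (hε : 0 < ε) :
    ∃ F : L2Circle, F ≠ 0 ∧ ∀ i, ‖circleMul (ψ i) F‖ ≤ ε * ‖F‖ := by
  let U : Set UnitAddCircle := {t | ∀ i, ‖ψ i t‖ < ε}
  have hU : IsOpen U := by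
    have : U = ⋂ i, {t | ‖ψ i t‖ < ε} := by ext; simp [U]
    rw [this]
    exact isOpen_iInter_of_finite fun i => isOpen_lt (by fun_prop) continuous_const
  have hyU : y ∈ U := fun i => by simpa [hψ i] using hε
  refine ⟨indicatorConstLp 2 hU.measurableSet (measure_ne_top _ _) 1, ?_, fun i => ?_⟩
  · rw [← norm_ne_zero_iff, norm_indicatorConstLp (by norm_num) (by norm_num)]
    have : 0 < (AddCircle.haarAddCircle : Measure UnitAddCircle).real U :=
      ENNReal.toReal_pos (hU.measure_pos _ ⟨y, hyU⟩).ne' (measure_ne_top _ _)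
    simp only [norm_one, one_mul]
    exact (Real.rpow_pos_of_pos this _).ne'
  · refine Lp.norm_le_mul_norm_of_ae_le_mul ?_
    filter_upwards [coeFn_circleMul (ψ i)
      (indicatorConstLp 2 hU.measurableSet (measure_ne_top _ _) 1),
      indicatorConstLp_coeFn (p := 2) (hs := hU.measurableSet)
        (hμs := measure_ne_top AddCircle.haarAddCircle U) (c := (1 : ℂ))] with t h1 h2
    rw [h1, h2, norm_mul]
    by_cases ht : t ∈ U
    · gcongr
      exact (ht i).le
    · simp [ht]

/-! ### Matrix symbols: boundedness, invertibility, failure of lower bounds -/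

/-- The operator on vectors of elements of `L²(ℝ/ℤ)` defined by a matrix symbol. -/
def symbolOp {ι κ : Type*} [Fintype κ] (Φ : Matrix ι κ C(UnitAddCircle, ℂ)) (F : κ → L2Circle)
    (i : ι) : L2Circle :=
  ∑ s, circleMul (Φ i s) (F s)

lemma symbolOp_one {ι : Type*} [Fintype ι] [DecidableEq ι] (F : ι → L2Circle) :
    symbolOp (1 : Matrix ι ι C(UnitAddCircle, ℂ)) F = F := by
  funext i
  simp only [symbolOp]
  rw [Finset.sum_eq_single i]
  · simp [circleMul_one]
  · intro s _ hs
    simp [Matrix.one_apply_ne hs.symm]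
  · simp

lemma symbolOp_mul {ι κ τ : Type*} [Fintype κ] [Fintype τ]
    (Φ : Matrix ι κ C(UnitAddCircle, ℂ)) (Ψ : Matrix κ τ C(UnitAddCircle, ℂ))
    (F : τ → L2Circle) : symbolOp (Φ * Ψ) F = symbolOp Φ (symbolOp Ψ F) := by
  funext i
  simp only [symbolOp, Matrix.mul_apply, map_sum, sum_apply, circleMul_mul]
  exact Finset.sum_comm

lemma exists_symbolOp_bound {ι κ : Type*} [Fintype ι] [Fintype κ]
    (Φ : Matrix ι κ C(UnitAddCircle, ℂ)) :
    ∃ B : ℝ, 0 < B ∧ ∀ F : κ → L2Circle,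
      ∑ i, ‖symbolOp Φ F i‖ ^ 2 ≤ B * ∑ s, ‖F s‖ ^ 2 := by
  refine ⟨∑ i, ∑ s, ‖circleMul (Φ i s)‖ ^ 2 + 1, by positivity, fun F => ?_⟩
  rw [add_mul, Finset.sum_mul]
  refine le_add_of_le_of_nonneg (Finset.sum_le_sum fun i _ => ?_) (by positivity)
  calc ‖symbolOp Φ F i‖ ^ 2 ≤ (∑ s, ‖circleMul (Φ i s)‖ * ‖F s‖) ^ 2 := by
        gcongr
        exact (norm_sum_le _ _).trans
          (Finset.sum_le_sum fun s _ => ContinuousLinearMap.le_opNorm _ _)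
    _ ≤ _ := Finset.sum_mul_sq_le_sq_mul_sq _ _ _

/-- A matrix of continuous functions that is invertible at every point is invertible. -/
lemma isUnit_matrix_of_det_ne_zero {ι : Type*} [Fintype ι] [DecidableEq ι]
    (Φ : Matrix ι ι C(UnitAddCircle, ℂ))
    (h : ∀ t, (Φ.map fun ψ => ψ t).det ≠ 0) : IsUnit Φ := by
  rw [Matrix.isUnit_iff_isUnit_det, ContinuousMap.isUnit_iff_forall_ne_zero]
  intro t
  have := (ContinuousMap.evalAlgHom ℂ ℂ t : C(UnitAddCircle, ℂ) →ₐ[ℂ] ℂ).toRingHom.map_det Φ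
  have h2 : Φ.det t = (Φ.map fun ψ => ψ t).det := this
  rw [h2]
  exact h t

/-- If the symbol is singular at some point, the operator is not bounded below. -/
lemma exists_symbolOp_small {ι : Type*} [Fintype ι] [DecidableEq ι]
    (Φ : Matrix ι ι C(UnitAddCircle, ℂ)) (y : UnitAddCircle)
    (h : (Φ.map fun ψ => ψ y).det = 0) {ε : ℝ} (hε : 0 < ε) :
    ∃ F : ι → L2Circle, 0 < ∑ s, ‖F s‖ ^ 2 ∧
      ∑ i, ‖symbolOp Φ F i‖ ^ 2 ≤ ε * ∑ s, ‖F s‖ ^ 2 := by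
  obtain ⟨v, hv0, hv⟩ := Matrix.exists_mulVec_eq_zero_iff.2 h
  have hvpos : 0 < ∑ s, ‖v s‖ ^ 2 := by
    obtain ⟨s, hs⟩ := Function.ne_iff.1 hv0
    exact Finset.sum_pos' (fun _ _ => by positivity)
      ⟨s, Finset.mem_univ _, by have : v s ≠ 0 := hs
                                positivity⟩
  have hc : 0 < (Fintype.card ι : ℝ) + 1 := by positivity
  -- Each row paired with the kernel vector `v` vanishes at `y`, so one localised `G` makes all rows
  -- small. The tolerance below shares `ε` among the rows.
  let ψ : ι → C(UnitAddCircle, ℂ) := fun i => ∑ s, v s • Φ i s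
  obtain ⟨G, hG, hψG⟩ := exists_norm_circleMul_le ψ y (fun i => by
    have := congrFun hv i
    simpa [ψ, Matrix.mulVec, dotProduct, mul_comm] using this)
    (ε := Real.sqrt (ε * (∑ s, ‖v s‖ ^ 2) / (Fintype.card ι + 1))) (by positivity)
  have hGpos : 0 < ‖G‖ := norm_pos_iff.2 hG
  refine ⟨fun s => v s • G, ?_, ?_⟩
  · simp only [norm_smul, mul_pow, ← Finset.sum_mul]
    positivity
  · have h1 : ∀ i, symbolOp Φ (fun s => v s • G) i = circleMul (ψ i) G := fun i => by
      simp [symbolOp, ψ]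
    calc ∑ i, ‖symbolOp Φ (fun s => v s • G) i‖ ^ 2
        ≤ ∑ _i : ι, ε * (∑ s, ‖v s‖ ^ 2) / (Fintype.card ι + 1) * ‖G‖ ^ 2 := by
          refine Finset.sum_le_sum fun i _ => ?_
          rw [h1]
          refine (pow_le_pow_left₀ (norm_nonneg _) (hψG i) 2).trans_eq ?_
          rw [mul_pow, Real.sq_sqrt (by positivity)]
      _ = (Fintype.card ι / (Fintype.card ι + 1)) * (ε * ((∑ s, ‖v s‖ ^ 2) * ‖G‖ ^ 2)) := by
          rw [Finset.sum_const, Finset.card_univ, nsmul_eq_mul]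
          ring
      _ ≤ 1 * (ε * ((∑ s, ‖v s‖ ^ 2) * ‖G‖ ^ 2)) := by
          gcongr
          rw [div_le_one hc]
          linarith
      _ = _ := by simp only [norm_smul, mul_pow, ← Finset.sum_mul, one_mul]

/-! ### Series of integer translates -/

lemma summable_one_add_abs_int_rpow {ε : ℝ} (hε : 0 < ε) :
    Summable fun k : ℤ => (1 + |(k : ℝ)|) ^ (-1 - ε) := by
  refine Summable.of_norm_bounded_eventually
    (Real.summable_abs_int_rpow (b := 1 + ε) (by linarith)) ?_
  -- At `k = 0` the comparison term is `0` by the convention for `rpow`, so the bound holds only off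
  -- `0`.
  filter_upwards [(Set.finite_singleton (0 : ℤ)).compl_mem_cofinite] with k hk
  have hk0 : 0 < |(k : ℝ)| := abs_pos.2 (by exact_mod_cast hk)
  rw [Real.norm_of_nonneg (by positivity), show -1 - ε = -(1 + ε) by ring]
  exact Real.rpow_le_rpow_of_nonpos hk0 (by linarith) (by linarith)

/-- Integer translates of a function decaying like `(1 + |t|)^(-1-ε)` are dominated, uniformly on
bounded sets, by a summable family. -/
lemma exists_summable_translate_bound {f : ℝ → ℂ} {ε C : ℝ} (hε : 0 < ε) (hC : 0 < C)
    (hf : ∀ t, ‖f t‖ ≤ C * (1 + |t|) ^ (-1 - ε)) (R : ℝ) :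
    ∃ u : ℤ → ℝ, Summable u ∧ ∀ k : ℤ, ∀ t ∈ Metric.ball (0 : ℝ) R, ‖f (t - k)‖ ≤ u k := by
  refine ⟨fun k => C * (1 + |R|) ^ (1 + ε) * (1 + |(k : ℝ)|) ^ (-1 - ε),
    (summable_one_add_abs_int_rpow hε).mul_left _, fun k t ht => (hf _).trans ?_⟩
  have ht' : |t| ≤ |R| := by
    rw [mem_ball_zero_iff, Real.norm_eq_abs] at ht
    exact ht.le.trans (le_abs_self R)
  have h1 : |(k : ℝ)| ≤ |t - k| + |t| := by
    have := abs_sub_abs_le_abs_sub (k : ℝ) t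
    rw [abs_sub_comm] at this
    linarith
  -- The weight is submultiplicative, so translation by a bounded `t` costs only a constant factor.
  have h2 : (1 + |(k : ℝ)|) / (1 + |R|) ≤ 1 + |t - k| := by
    rw [div_le_iff₀ (by positivity)]
    nlinarith [abs_nonneg (t - k), abs_nonneg R]
  beta_reduce
  rw [mul_assoc]
  gcongr
  calc (1 + |t - k|) ^ (-1 - ε) ≤ ((1 + |(k : ℝ)|) / (1 + |R|)) ^ (-1 - ε) :=
        Real.rpow_le_rpow_of_nonpos (by positivity) h2 (by linarith)
    _ = _ := by
        rw [Real.div_rpow (by positivity) (by positivity), show -1 - ε = -(1 + ε) by ring,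
          Real.rpow_neg (x := 1 + |R|) (by positivity)]
        field_simp

/-- The series `∑ₖ dₖ f(t - k)`. -/
def shiftSeries (d : ℤ → ℂ) (f : ℝ → ℂ) (t : ℝ) : ℂ := ∑' k : ℤ, d k * f (t - k)

/-- Boundedness of `d` is enough because the decay of `f` gives summability; this covers both `ℓ²`
coefficients and the unimodular exponentials of the Zak transform. -/
lemma exists_summable_shiftSeries_bound {d : ℤ → ℂ} {D : ℝ} (hd : ∀ k, ‖d k‖ ≤ D) {f : ℝ → ℂ}
    {ε C : ℝ} (hε : 0 < ε) (hC : 0 < C) (hf : ∀ t, ‖f t‖ ≤ C * (1 + |t|) ^ (-1 - ε)) (R : ℝ) :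
    ∃ u : ℤ → ℝ, Summable u ∧
      ∀ k : ℤ, ∀ t ∈ Metric.ball (0 : ℝ) R, ‖d k * f (t - k)‖ ≤ u k := by
  obtain ⟨u, hu, hfu⟩ := exists_summable_translate_bound hε hC hf R
  refine ⟨fun k => D * u k, hu.mul_left _, fun k t ht => ?_⟩
  rw [norm_mul]
  exact mul_le_mul (hd k) (hfu k t ht) (norm_nonneg _) ((norm_nonneg _).trans (hd k))

lemma summable_shiftSeries {d : ℤ → ℂ} {D : ℝ} (hd : ∀ k, ‖d k‖ ≤ D) {f : ℝ → ℂ}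
    {ε C : ℝ} (hε : 0 < ε) (hC : 0 < C) (hf : ∀ t, ‖f t‖ ≤ C * (1 + |t|) ^ (-1 - ε)) (t : ℝ) :
    Summable fun k : ℤ => d k * f (t - k) := by
  obtain ⟨u, hu, h⟩ := exists_summable_shiftSeries_bound hd hε hC hf (|t| + 1)
  exact Summable.of_norm_bounded hu fun k => h k t (by simp)

lemma continuous_shiftSeries {d : ℤ → ℂ} {D : ℝ} (hd : ∀ k, ‖d k‖ ≤ D) {f : ℝ → ℂ}
    (hcont : Continuous f)
    {ε C : ℝ} (hε : 0 < ε) (hC : 0 < C) (hf : ∀ t, ‖f t‖ ≤ C * (1 + |t|) ^ (-1 - ε)) :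
    Continuous (shiftSeries d f) := by
  rw [continuous_iff_continuousAt]
  intro t
  obtain ⟨u, hu, h⟩ := exists_summable_shiftSeries_bound hd hε hC hf (|t| + 1)
  have : ContinuousOn (shiftSeries d f) (Metric.ball 0 (|t| + 1)) :=
    continuousOn_tsum (fun k => by fun_prop) hu h
  exact this.continuousAt (Metric.isOpen_ball.mem_nhds (by simp))

lemma hasDerivAt_shiftSeries {d : ℤ → ℂ} {D : ℝ} (hd : ∀ k, ‖d k‖ ≤ D) {f f' : ℝ → ℂ}
    (hderiv : ∀ t, HasDerivAt f (f' t) t) {ε C : ℝ} (hε : 0 < ε) (hC : 0 < C)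
    (hf : ∀ t, ‖f t‖ ≤ C * (1 + |t|) ^ (-1 - ε))
    (hf' : ∀ t, ‖f' t‖ ≤ C * (1 + |t|) ^ (-1 - ε)) (t : ℝ) :
    HasDerivAt (shiftSeries d f) (shiftSeries d f' t) t := by
  obtain ⟨u, hu, h⟩ := exists_summable_shiftSeries_bound hd hε hC hf' (|t| + 1)
  have ht : t ∈ Metric.ball (0 : ℝ) (|t| + 1) := by simp
  exact hasDerivAt_tsum_of_isPreconnected hu Metric.isOpen_ball
    (convex_ball (0 : ℝ) _).isPreconnected
    (fun k y _ => ((hderiv (y - k)).comp_sub_const y (k : ℝ)).const_mul (d k))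
    h ht (summable_shiftSeries hd hε hC hf t) ht

lemma iteratedDeriv_shiftSeries {d : ℤ → ℂ} {D : ℝ} (hd : ∀ k, ‖d k‖ ≤ D) {m : ℕ} {φ : ℝ → ℂ}
    (hφ : ContDiff ℝ (m : WithTop ℕ∞) φ) {ε C : ℝ} (hε : 0 < ε) (hC : 0 < C)
    (hb : ∀ s ≤ m, ∀ t, ‖iteratedDeriv s φ t‖ ≤ C * (1 + |t|) ^ (-1 - ε)) {s : ℕ} (hs : s ≤ m) :
    iteratedDeriv s (shiftSeries d φ) = shiftSeries d (iteratedDeriv s φ) := by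
  induction s with
  | zero => simp
  | succ s ih =>
    rw [iteratedDeriv_succ, ih (by omega)]
    funext t
    refine (hasDerivAt_shiftSeries hd (fun y => ?_) hε hC (hb s (by omega)) (hb _ hs) t).deriv
    rw [iteratedDeriv_succ]
    exact (hφ.differentiable_iteratedDeriv s (by exact_mod_cast hs) y).hasDerivAt

lemma contDiff_shiftSeries {d : ℤ → ℂ} {D : ℝ} (hd : ∀ k, ‖d k‖ ≤ D) {m : ℕ} {φ : ℝ → ℂ}
    (hφ : ContDiff ℝ (m : WithTop ℕ∞) φ) {ε C : ℝ} (hε : 0 < ε) (hC : 0 < C)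
    (hb : ∀ s ≤ m, ∀ t, ‖iteratedDeriv s φ t‖ ≤ C * (1 + |t|) ^ (-1 - ε)) :
    ContDiff ℝ (m : WithTop ℕ∞) (shiftSeries d φ) := by
  rw [show (m : WithTop ℕ∞) = ((m : ℕ∞) : WithTop ℕ∞) from rfl, contDiff_iff_iteratedDeriv]
  refine ⟨fun s hs => ?_, fun s hs => ?_⟩
  · have hs' : s ≤ m := by exact_mod_cast hs
    rw [iteratedDeriv_shiftSeries hd hφ hε hC hb hs']
    exact continuous_shiftSeries hd (hφ.continuous_iteratedDeriv s (by exact_mod_cast hs'))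
      hε hC (hb s hs')
  · have hs' : s < m := by exact_mod_cast hs
    rw [iteratedDeriv_shiftSeries hd hφ hε hC hb hs'.le]
    intro t
    refine (hasDerivAt_shiftSeries (f' := iteratedDeriv (s + 1) φ) hd (fun y => ?_) hε hC
      (hb s hs'.le) (hb _ hs') t).differentiableAt
    rw [iteratedDeriv_succ]
    exact (hφ.differentiable_iteratedDeriv s (by exact_mod_cast hs') y).hasDerivAt

/-- A series of translates converging in `L²(ℝ)` and pointwise has the same sum in both senses. -/
lemma shiftSeries_ae_eq {φ : ℝ → ℂ} {hφ : MemLp φ 2 volume} {d : ℤ → ℂ} {f : L2R}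
    (hf : HasSum (fun k => d k • shiftL2 φ hφ k) f)
    (hsum : ∀ t : ℝ, Summable fun k : ℤ => d k * φ (t - k)) :
    shiftSeries d φ =ᵐ[volume] f := by
  -- Convergence in `L²` gives convergence in measure, hence almost everywhere along a sequence of
  -- finite index sets; the pointwise sum has the same limit along it.
  obtain ⟨ns, hns, hae⟩ := (tendstoInMeasure_of_tendsto_Lp hf).exists_seq_tendsto_ae'
  have hcoe : ∀ k : ℤ, ((d k • shiftL2 φ hφ k : L2R) : ℝ → ℂ) =ᵐ[volume]
      fun t => d k * φ (t - k) := fun k => by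
    filter_upwards [Lp.coeFn_smul (d k) (shiftL2 φ hφ k),
      (hφ.comp_measurePreserving (measurePreserving_sub_right volume (k : ℝ))).coeFn_toLp]
      with t h1 h2
    rw [h1, Pi.smul_apply, smul_eq_mul]
    congr 1
  have hfin : ∀ n, ((∑ k ∈ ns n, d k • shiftL2 φ hφ k : L2R) : ℝ → ℂ) =ᵐ[volume]
      fun t => ∑ k ∈ ns n, d k * φ (t - k) := fun n => by
    filter_upwards [Lp.coeFn_finsetSum (ns n) fun k => d k • shiftL2 φ hφ k,
      ae_all_iff.2 hcoe] with t h1 h2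
    rw [h1, Finset.sum_apply]
    exact Finset.sum_congr rfl fun k _ => h2 k
  filter_upwards [hae, ae_all_iff.2 hfin] with t h1 h2
  simp only [h2] at h1
  exact tendsto_nhds_unique ((hsum t).hasSum.comp hns) h1

lemma norm_le_of_summable_sq {d : ℤ → ℂ} (hd : Summable fun k => ‖d k‖ ^ 2) (k : ℤ) :
    ‖d k‖ ≤ Real.sqrt (∑' k, ‖d k‖ ^ 2) :=
  Real.le_sqrt_of_sq_le (hd.le_tsum k fun _ _ => by positivity)

lemma HasSum.of_eq {ι E : Type*} [AddCommMonoid E] [TopologicalSpace E] {f g : ι → E} {S : E}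
    (hf : HasSum f S) (h : ∀ k, g k = f k) : HasSum g S := by
  rwa [funext h]

/-! ### Residue classes and the symbol of sampling -/

/-- Summation over `ℤ` by residue classes modulo `ρ`. -/
lemma sum_residues_eq {E : Type*} [AddCommMonoid E] [TopologicalSpace E] [ContinuousAdd E]
    [T3Space E] {ρ : ℕ} [NeZero ρ] {g : ℤ → E} {S : E}
    (hg : HasSum g S) {c : Fin ρ → E}
    (h : ∀ s : Fin ρ, HasSum (fun m : ℤ => g (m * ρ + (s : ℕ))) (c s)) : ∑ s, c s = S := by
  have h1 : HasSum (fun q : ℤ × Fin ρ => g (q.1 * ρ + (q.2 : ℕ))) S :=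
    ((Int.divModEquiv ρ).symm.hasSum_iff (f := g)).2 hg
  have h2 : HasSum (fun q : Fin ρ × ℤ => g (q.2 * ρ + (q.1 : ℕ))) S :=
    ((Equiv.prodComm (Fin ρ) ℤ).hasSum_iff
      (f := fun q : ℤ × Fin ρ => g (q.1 * ρ + (q.2 : ℕ)))).2 h1
  exact (hasSum_fintype c).unique (h2.prod_fiberwise h)

/-- A sequence assembled from its residue classes modulo `ρ`. -/
lemma exists_interleave {E : Type*} {ρ : ℕ} [NeZero ρ] (a : Fin ρ → ℤ → E) :
    ∃ d : ℤ → E, ∀ (s : Fin ρ) m, d (m * ρ + (s : ℕ)) = a s m := by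
  refine ⟨fun k => a (Int.divModEquiv ρ k).2 (Int.divModEquiv ρ k).1, fun s m => ?_⟩
  have : Int.divModEquiv ρ (m * ρ + (s : ℕ)) = (m, s) :=
    (Int.divModEquiv ρ).apply_symm_apply (m, s)
  simp only [this]

lemma summable_of_residues {ρ : ℕ} [NeZero ρ] {g : ℤ → ℝ}
    (h : ∀ s : Fin ρ, Summable fun m : ℤ => g (m * ρ + (s : ℕ))) (hg : ∀ k, 0 ≤ g k) :
    Summable g := by
  have h2 : Summable (fun q : Fin ρ × ℤ => g (q.2 * ρ + (q.1 : ℕ))) :=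
    (summable_prod_of_nonneg fun q => hg _).2 ⟨h, (hasSum_fintype _).summable⟩
  have h1 : Summable (fun q : ℤ × Fin ρ => g (q.1 * ρ + (q.2 : ℕ))) :=
    ((Equiv.prodComm (Fin ρ) ℤ).summable_iff
      (f := fun q : ℤ × Fin ρ => g (q.1 * ρ + (q.2 : ℕ)))).1 h2
  exact ((Int.divModEquiv ρ).symm.summable_iff (f := g)).1 h1

lemma summable_residue {E : Type*} [NormedAddCommGroup E] [CompleteSpace E] {ρ : ℕ} [NeZero ρ]
    {g : ℤ → E} (hg : Summable g) (s : Fin ρ) :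
    Summable fun m : ℤ => g (m * ρ + (s : ℕ)) :=
  hg.comp_injective fun a b h => by
    simpa [NeZero.ne ρ] using h

/-- The symbol of the operator sending `d` to the samples `fᵢ(tᵢ + ρ l)` of
`fᵢ = ∑ₖ dₖ hᵢ(· - k)`. -/
def sampleSymbol {ι : Type*} (ρ : ℕ) (h : ι → ℝ → ℂ) (t : ι → ℝ) :
    Matrix ι (Fin ρ) C(UnitAddCircle, ℂ) :=
  Matrix.of fun i s => trigSeries fun n : ℤ => h i (t i + ρ * n - (s : ℕ))

section Symbol

variable {ι : Type*} {ρ : ℕ} [NeZero ρ] {h : ι → ℝ → ℂ} {t : ι → ℝ}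

lemma summable_sampleSymbol_coeff {f : ℝ → ℂ} {ε C : ℝ} (hε : 0 < ε) (hC : 0 < C)
    (hf : ∀ u, ‖f u‖ ≤ C * (1 + |u|) ^ (-1 - ε)) (u : ℝ) (s : Fin ρ) :
    Summable fun n : ℤ => f (u + ρ * n - (s : ℕ)) := by
  have h1 := summable_shiftSeries (d := fun _ => 1) (D := 1) (by simp) hε hC hf u
  have h2 := (Equiv.neg ℤ).summable_iff.2 (summable_residue h1 s)
  refine h2.congr fun n => ?_
  simp only [Function.comp_apply, Equiv.neg_apply, one_mul]
  push_cast
  congr 1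
  ring

/-- In the Fourier domain, sampling is multiplication by the symbol. -/
lemma fourierCoeff_symbolOp_sampleSymbol {ε C : ℝ} (hε : 0 < ε) (hC : 0 < C)
    (hh : ∀ i u, ‖h i u‖ ≤ C * (1 + |u|) ^ (-1 - ε))
    {d : ℤ → ℂ} {D : ℝ} (hd : ∀ k, ‖d k‖ ≤ D)
    {F : Fin ρ → L2Circle} (hF : ∀ s m, fourierCoeff (F s) m = d (m * ρ + (s : ℕ)))
    (i : ι) (l : ℤ) :
    fourierCoeff (symbolOp (sampleSymbol ρ h t) F i) l = shiftSeries d (h i) (t i + ρ * l) := by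
  rw [← fourierCoeffCLM_apply, symbolOp, map_sum]
  refine sum_residues_eq (summable_shiftSeries hd hε hC (hh i) (t i + ρ * l)).hasSum fun s => ?_
  rw [fourierCoeffCLM_apply]
  have h1 := fourierCoeff_circleMul_trigSeries
    (summable_sampleSymbol_coeff hε hC (hh i) (t i) s) (F s) l
  have h2 := (Equiv.subLeft l).hasSum_iff.2 h1
  refine h2.of_eq fun m => ?_
  simp only [Function.comp_apply, Equiv.subLeft_apply, sub_sub_cancel, hF]
  rw [mul_comm]
  push_cast
  congr 2
  ring

lemma sampleSymbol_apply {ε C : ℝ} (hε : 0 < ε) (hC : 0 < C)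
    (hh : ∀ i u, ‖h i u‖ ≤ C * (1 + |u|) ^ (-1 - ε))
    (i : ι) (s : Fin ρ) (y : UnitAddCircle) :
    HasSum (fun n : ℤ => h i (t i + ρ * n - (s : ℕ)) * fourier n y) (sampleSymbol ρ h t i s y) := by
  have hs := summable_sampleSymbol_coeff hε hC (hh i) (t i) s
  have := (hasSum_trigSeries hs).map (ContinuousMap.evalCLM ℂ y) (by fun_prop)
  simpa [Function.comp_def, sampleSymbol] using this

/-- For `k = m ρ + s` the exponential splits into the character of index `-m` at `y`, the factor
`exp(2πi m j) = 1`, and the `s`-th power of a node. Thus `j` enters only through the node, which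
gives the Vandermonde factor. -/
lemma shiftSeries_exp_eq {ε C : ℝ} (hε : 0 < ε) (hC : 0 < C)
    (hh : ∀ i u, ‖h i u‖ ≤ C * (1 + |u|) ^ (-1 - ε))
    (i : ι) (y : ℝ) (j : ℕ) :
    shiftSeries (fun k => Complex.exp (2 * Real.pi * Complex.I * (k * ((-y + j) / ρ)))) (h i) (t i)
      = ∑ s : Fin ρ, sampleSymbol ρ h t i s (y : UnitAddCircle) *
        Complex.exp (2 * Real.pi * Complex.I * ((-y + j) / ρ)) ^ (s : ℕ) := by
  have hd : ∀ k : ℤ, ‖Complex.exp (2 * Real.pi * Complex.I * (k * ((-y + j) / ρ)))‖ ≤ 1 := by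
    intro k
    rw [show (2 * Real.pi * Complex.I * (k * ((-y + j) / ρ)) : ℂ) =
      ((2 * Real.pi * (k * ((-y + j) / ρ)) : ℝ) : ℂ) * Complex.I by push_cast; ring,
      Complex.norm_exp_ofReal_mul_I]
  refine (sum_residues_eq (summable_shiftSeries hd hε hC (hh i) (t i)).hasSum fun s => ?_).symm
  have h1 := (sampleSymbol_apply (t := t) hε hC hh i s (y : UnitAddCircle)).mul_right
    (Complex.exp (2 * Real.pi * Complex.I * ((-y + j) / ρ)) ^ (s : ℕ))
  have h2 := (Equiv.neg ℤ).hasSum_iff.2 h1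
  refine h2.of_eq fun m => ?_
  have hρ : (ρ : ℂ) ≠ 0 := Nat.cast_ne_zero.2 (NeZero.ne ρ)
  simp only [Function.comp_apply, Equiv.neg_apply, fourier_coe_apply]
  rw [mul_comm (Complex.exp _), mul_assoc (h i _), ← Complex.exp_nat_mul, ← Complex.exp_add]
  congr 1
  · push_cast
    congr 1
    ring
  · rw [Complex.exp_eq_exp_iff_exists_int]
    refine ⟨m * j, ?_⟩
    push_cast
    field_simp
    ring

end Symbol

/-- The transpose is Vandermonde; two equal nodes would force their indices to agree modulo `ρ`. -/
lemma det_exp_matrix_ne_zero {ρ : ℕ} (y : ℝ) :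
    (Matrix.of fun s j : Fin ρ =>
      Complex.exp (2 * Real.pi * Complex.I * ((-y + (j : ℕ)) / ρ)) ^ (s : ℕ)).det ≠ 0 := by
  rw [← Matrix.det_transpose]
  refine Matrix.det_vandermonde_ne_zero_iff (v := fun j : Fin ρ =>
    Complex.exp (2 * Real.pi * Complex.I * ((-y + (j : ℕ)) / ρ))).2 fun a b hab => ?_
  obtain ⟨n, hn⟩ := Complex.exp_eq_exp_iff_exists_int.1 hab
  have hρ : (ρ : ℂ) ≠ 0 := Nat.cast_ne_zero.2 (by have := a.2; omega)
  have h2 : ((a : ℕ) : ℂ) = (b : ℕ) + n * ρ := by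
    have hp := Complex.two_pi_I_ne_zero
    have h3 : (2 * Real.pi * Complex.I) * ((-y + (a : ℕ)) / ρ) =
      (2 * Real.pi * Complex.I) * ((-y + (b : ℕ)) / ρ + n) := by rw [hn]; ring
    have h4 := mul_left_cancel₀ hp h3
    field_simp at h4
    linear_combination h4
  have h5 : ((a : ℕ) : ℤ) = (b : ℕ) + n * ρ := by exact_mod_cast h2
  have ha := Nat.mod_eq_of_lt a.2
  have hb := Nat.mod_eq_of_lt b.2
  have h6 : ((a : ℕ) : ℤ) % ρ = ((b : ℕ) : ℤ) % ρ := by rw [h5, Int.add_mul_emod_self_right]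
  apply Fin.ext
  have : (a : ℕ) % ρ = (b : ℕ) % ρ := by exact_mod_cast h6
  omega

/-! ### The symbol of the periodic sampling set and the Zak matrix -/

lemma ClassA.bound {m : ℕ} {φ : ℝ → ℂ} (hA : ClassA (m + 1) φ) :
    ContDiff ℝ (m : WithTop ℕ∞) φ ∧ ∃ ε C : ℝ, 0 < ε ∧ 0 < C ∧
      ∀ s ≤ m, ∀ t, ‖iteratedDeriv s φ t‖ ≤ C * (1 + |t|) ^ (-1 - ε) := by
  obtain ⟨h, ε, C, hε, hC, hb⟩ := hA
  exact ⟨h, ε, C, hε, hC, fun s hs => (hb s (Nat.lt_succ_of_le hs)).1⟩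

lemma IsRegularRep.unique {m : ℕ} {f : L2R} {g g' : ℝ → ℂ} (h : IsRegularRep m f g)
    (h' : IsRegularRep m f g') : g = g' :=
  (Continuous.ae_eq_iff_eq volume h.1.continuous h'.1.continuous).1 (h.2.trans h'.2.symm)

/-- The symbol of the sampling operator attached to the periodic nonuniform sampling set. -/
def pnsSymbol (φ : ℝ → ℂ) {L r ρ : ℕ} (hρ : ρ = L * r) (x : Fin L → ℝ) :
    Matrix (Fin ρ) (Fin ρ) C(UnitAddCircle, ℂ) :=
  sampleSymbol ρ (fun i => iteratedDeriv ((i : ℕ) % r) φ) fun i => x (Fin.cast hρ i).divNat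

section

variable {L m ρ : ℕ} [NeZero ρ] (hρ : ρ = L * (m + 1)) {φ : ℝ → ℂ} (x : Fin L → ℝ)

lemma isRegularRep_shiftSeries (hA : ClassA (m + 1) φ) {hφ : MemLp φ 2 volume} {d : ℤ → ℂ}
    (hd : Summable fun k => ‖d k‖ ^ 2) {f : L2R} (hf : HasSum (fun k => d k • shiftL2 φ hφ k) f) :
    IsRegularRep m f (shiftSeries d φ) := by
  obtain ⟨hc, ε, C, hε, hC, hb⟩ := hA.bound
  refine ⟨contDiff_shiftSeries (norm_le_of_summable_sq hd) hc hε hC hb,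
    shiftSeries_ae_eq hf fun t => ?_⟩
  exact summable_shiftSeries (norm_le_of_summable_sq hd) hε hC
    (by simpa using hb 0 (Nat.zero_le _)) t

/-- The row index `n (m + 1) + p` encodes the node `n` (quotient) and the derivative order `p`
(remainder). -/
lemma fourierCoeff_pnsSymbol (hA : ClassA (m + 1) φ) {d : ℤ → ℂ}
    (hd : Summable fun k => ‖d k‖ ^ 2) {F : Fin ρ → L2Circle}
    (hF : ∀ s n, fourierCoeff (F s) n = d (n * ρ + (s : ℕ))) (n : Fin L) (p : Fin (m + 1))
    (l : ℤ) :
    fourierCoeff (symbolOp (pnsSymbol φ hρ x) F (Fin.cast hρ.symm (finProdFinEquiv (n, p)))) l =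
      iteratedDeriv p (shiftSeries d φ) (x n + ρ * l) := by
  obtain ⟨hc, ε, C, hε, hC, hb⟩ := hA.bound
  have hi : ∀ i : Fin ρ, (i : ℕ) % (m + 1) ≤ m := fun i =>
    Nat.le_of_lt_succ (Nat.mod_lt _ (Nat.succ_pos m))
  rw [pnsSymbol, fourierCoeff_symbolOp_sampleSymbol hε hC (fun i => hb _ (hi i))
    (norm_le_of_summable_sq hd) hF,
    iteratedDeriv_shiftSeries (norm_le_of_summable_sq hd) hc hε hC hb (Nat.le_of_lt_succ p.2)]
  have h := finProdFinEquiv.symm_apply_apply (n, p)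
  have h1 : (finProdFinEquiv (n, p)).divNat = n := congrArg Prod.fst h
  have h2 : (finProdFinEquiv (n, p)).modNat = p := congrArg Prod.snd h
  have h3 : ((finProdFinEquiv (n, p) : Fin (L * (m + 1))) : ℕ) % (m + 1) = p :=
    congrArg Fin.val h2
  simp only [Fin.cast_cast, Fin.cast_eq_self, Fin.val_cast, h1, h3]

/-- Parseval row by row. Indexing by `Fin L × ℤ` counts coinciding sampling points with
multiplicity, so distinctness is not needed here. -/
lemma hasSum_sq_samples (hA : ClassA (m + 1) φ) {d : ℤ → ℂ}
    (hd : Summable fun k => ‖d k‖ ^ 2) {F : Fin ρ → L2Circle}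
    (hF : ∀ s n, fourierCoeff (F s) n = d (n * ρ + (s : ℕ))) :
    HasSum (fun q : Fin L × ℤ => ∑ p ∈ Finset.range (m + 1),
        ‖iteratedDeriv p (shiftSeries d φ) (x q.1 + ρ * q.2)‖ ^ 2)
      (∑ i, ‖symbolOp (pnsSymbol φ hρ x) F i‖ ^ 2) := by
  set G := symbolOp (pnsSymbol φ hρ x) F with hG
  have e : ∑ i, ‖G i‖ ^ 2 = ∑ n : Fin L, ∑ p : Fin (m + 1),
      ‖G (Fin.cast hρ.symm (finProdFinEquiv (n, p)))‖ ^ 2 := by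
    rw [← Fintype.sum_prod_type',
      ← (finProdFinEquiv.trans (finCongr hρ.symm)).sum_comp fun i => ‖G i‖ ^ 2]
    rfl
  have h1 : ∀ n : Fin L, HasSum (fun l : ℤ => ∑ p ∈ Finset.range (m + 1),
        ‖iteratedDeriv p (shiftSeries d φ) (x n + ρ * l)‖ ^ 2)
      (∑ p : Fin (m + 1), ‖G (Fin.cast hρ.symm (finProdFinEquiv (n, p)))‖ ^ 2) := fun n => by
    simp only [Finset.sum_range]
    refine hasSum_sum fun p _ => ?_
    have := hasSum_sq_fourierCoeff_L2 (G (Fin.cast hρ.symm (finProdFinEquiv (n, p))))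
    simpa only [hG, fourierCoeff_pnsSymbol hρ x hA hd hF] using this
  have hs : Summable (fun q : Fin L × ℤ => ∑ p ∈ Finset.range (m + 1),
        ‖iteratedDeriv p (shiftSeries d φ) (x q.1 + ρ * q.2)‖ ^ 2) :=
    (summable_prod_of_nonneg fun q => Finset.sum_nonneg fun _ _ => by positivity).2
      ⟨fun n => (h1 n).summable, (hasSum_fintype _).summable⟩
  rw [e, ← (hs.hasSum.prod_fiberwise h1).unique (hasSum_fintype _)]
  exact hs.hasSum

lemma zakMatrix_eq (hA : ClassA (m + 1) φ) (y : ℝ) :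
    zakMatrix φ hρ x y = (pnsSymbol φ hρ x).map (fun ψ => ψ (y : UnitAddCircle)) *
      Matrix.of fun s j : Fin ρ =>
        Complex.exp (2 * Real.pi * Complex.I * ((-y + (j : ℕ)) / ρ)) ^ (s : ℕ) := by
  obtain ⟨hc, ε, C, hε, hC, hb⟩ := hA.bound
  have hi : ∀ i : Fin ρ, (i : ℕ) % (m + 1) ≤ m := fun i =>
    Nat.le_of_lt_succ (Nat.mod_lt _ (Nat.succ_pos m))
  ext i j
  have h1 : (fun t => zakU φ ρ j t y) = shiftSeries
      (fun k => Complex.exp (2 * Real.pi * Complex.I * (k * ((-y + (j : ℕ)) / ρ)))) φ := by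
    funext t
    simp only [zakU, zak, shiftSeries]
    refine tsum_congr fun k => ?_
    push_cast
    rw [mul_comm, one_mul, one_mul]
  have hd : ∀ k : ℤ,
      ‖Complex.exp (2 * Real.pi * Complex.I * (k * ((-y + (j : ℕ)) / ρ)))‖ ≤ 1 := by
    intro k
    rw [show (2 * Real.pi * Complex.I * (k * ((-y + (j : ℕ)) / ρ)) : ℂ) =
      ((2 * Real.pi * (k * ((-y + (j : ℕ)) / ρ)) : ℝ) : ℂ) * Complex.I by push_cast; ring,
      Complex.norm_exp_ofReal_mul_I]
  simp only [zakMatrix, Matrix.of_apply, h1]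
  rw [iteratedDeriv_shiftSeries hd hc hε hC hb (hi i),
    shiftSeries_exp_eq (h := fun i : Fin ρ => iteratedDeriv ((i : ℕ) % (m + 1)) φ)
      (t := fun i => x (Fin.cast hρ i).divNat) hε hC (fun i => hb _ (hi i)) i y j]
  simp [Matrix.mul_apply, pnsSymbol]

lemma det_zakMatrix_ne_zero_iff (hA : ClassA (m + 1) φ) (y : ℝ) :
    (zakMatrix φ hρ x y).det ≠ 0 ↔
      ((pnsSymbol φ hρ x).map fun ψ => ψ (y : UnitAddCircle)).det ≠ 0 := by
  rw [zakMatrix_eq hρ x hA, Matrix.det_mul]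
  simp [det_exp_matrix_ne_zero]

lemma forall_det_zakMatrix_ne_zero_iff (hA : ClassA (m + 1) φ) :
    (∀ y ∈ Set.Icc (0 : ℝ) 1, (zakMatrix φ hρ x y).det ≠ 0) ↔
      ∀ y : UnitAddCircle, ((pnsSymbol φ hρ x).map fun ψ => ψ y).det ≠ 0 := by
  simp only [det_zakMatrix_ne_zero_iff hρ x hA]
  refine ⟨fun h y => ?_, fun h y _ => h y⟩
  obtain ⟨y, rfl⟩ := QuotientAddGroup.mk_surjective y
  have h1 := h (Int.fract y) ⟨Int.fract_nonneg y, (Int.fract_lt_one y).le⟩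
  rw [AddCircle.coe_fract] at h1
  exact h1

/-- If the symbol is invertible at the origin, the sampling points are pairwise distinct. -/
lemma pns_injective (hA : ClassA (m + 1) φ)
    (h : ((pnsSymbol φ hρ x).map fun ψ => ψ (0 : UnitAddCircle)).det ≠ 0) :
    Function.Injective fun q : Fin L × ℤ => x q.1 + ρ * q.2 := by
  obtain ⟨hc, ε, C, hε, hC, hb⟩ := hA.bound
  have hi : ∀ i : Fin ρ, (i : ℕ) % (m + 1) ≤ m := fun i =>
    Nat.le_of_lt_succ (Nat.mod_lt _ (Nat.succ_pos m))
  rintro ⟨n, l⟩ ⟨n', l'⟩ heq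
  simp only at heq
  by_cases hn : n = n'
  · subst hn
    have : (ρ : ℝ) ≠ 0 := Nat.cast_ne_zero.2 (NeZero.ne ρ)
    simpa [this] using heq
  · exfalso
    let e := finProdFinEquiv.trans (finCongr hρ.symm)
    have hne : e (n, 0) ≠ e (n', 0) := fun h => hn (congrArg Prod.fst (e.injective h))
    refine h (Matrix.det_zero_of_row_eq hne (funext fun s => ?_))
    have key : ∀ k : Fin L, HasSum (fun j : ℤ => φ (x k + ρ * j - (s : ℕ)))
        (pnsSymbol φ hρ x (e (k, 0)) s 0) := fun k => by
      have h0 := sampleSymbol_apply (h := fun i : Fin ρ => iteratedDeriv ((i : ℕ) % (m + 1)) φ)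
        (t := fun i => x (Fin.cast hρ i).divNat) hε hC (fun i => hb _ (hi i)) (e (k, 0)) s 0
      have h := finProdFinEquiv.symm_apply_apply (k, (0 : Fin (m + 1)))
      have h1 : (finProdFinEquiv (k, (0 : Fin (m + 1)))).divNat = k := congrArg Prod.fst h
      have h2 : (finProdFinEquiv (k, (0 : Fin (m + 1)))).modNat = 0 := congrArg Prod.snd h
      have h3 : ((finProdFinEquiv (k, 0) : Fin (L * (m + 1))) : ℕ) % (m + 1) = 0 :=
        congrArg Fin.val h2
      simpa only [pnsSymbol, fourier_eval_zero, mul_one, e, Equiv.trans_apply, finCongr_apply, Fin.val_cast,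
        Fin.cast_cast, Fin.cast_eq_self, h1, h3, iteratedDeriv_zero] using h0
    simp only [Matrix.map_apply]
    -- At the origin all characters equal `1`, so moving a node by a multiple of `ρ` merely
    -- reindexes the sum: a repeated point would give two equal rows of order `0`.
    refine ((Equiv.addRight (l - l')).hasSum_iff.2 (key n)).unique
      ((key n').of_eq fun j => ?_)
    simp only [Function.comp_apply, Equiv.coe_addRight]
    push_cast
    congr 1
    linear_combination heq

end

/-! ### The two implications -/

section

variable {ρ : ℕ} [NeZero ρ]

/-- Decomposition of a square summable sequence into its residue classes modulo `ρ`, each read as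
the Fourier coefficients of an element of `L²(ℝ/ℤ)`. -/
lemma exists_residue_functions {d : ℤ → ℂ} (hd : Summable fun k => ‖d k‖ ^ 2) :
    ∃ F : Fin ρ → L2Circle, ∀ s n, fourierCoeff (F s) n = d (n * ρ + (s : ℕ)) := by
  choose F hF using fun s : Fin ρ => exists_fourierCoeff_eq (summable_residue hd s)
  exact ⟨F, hF⟩

lemma exists_sequence_of_residue_functions (F : Fin ρ → L2Circle) :
    ∃ d : ℤ → ℂ, Summable (fun k => ‖d k‖ ^ 2) ∧
      ∀ (s : Fin ρ) n, fourierCoeff (F s) n = d (n * ρ + (s : ℕ)) := by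
  obtain ⟨d, hd⟩ := exists_interleave fun (s : Fin ρ) n => fourierCoeff (F s) n
  refine ⟨d, summable_of_residues (ρ := ρ) (fun s => ?_) fun k => by positivity,
    fun s n => (hd s n).symm⟩
  simpa only [hd] using (hasSum_sq_fourierCoeff_L2 (F s)).summable

lemma sum_sq_norm_eq_tsum {d : ℤ → ℂ} (hd : Summable fun k => ‖d k‖ ^ 2)
    {F : Fin ρ → L2Circle} (hF : ∀ s n, fourierCoeff (F s) n = d (n * ρ + (s : ℕ))) :
    ∑ s, ‖F s‖ ^ 2 = ∑' k, ‖d k‖ ^ 2 :=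
  sum_residues_eq hd.hasSum fun s => by
    simpa only [hF] using hasSum_sq_fourierCoeff_L2 (F s)

variable {L m : ℕ} (hρ : ρ = L * (m + 1)) {φ : ℝ → ℂ} {hφ : MemLp φ 2 volume} (x : Fin L → ℝ)

/-- Stable sampling forces the symbol to be invertible everywhere. -/
lemma det_pnsSymbol_ne_zero_of_isStableSampling (hA : ClassA (m + 1) φ)
    (hstable : IsStableGenerator φ hφ) (h : IsStableSampling φ hφ m (pnsSet (ρ : ℝ) x))
    (y : UnitAddCircle) : ((pnsSymbol φ hρ x).map fun ψ => ψ y).det ≠ 0 := by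
  intro hdet
  obtain ⟨-, A', B', hA', -, hRiesz⟩ := hstable
  obtain ⟨A, B, hApos, -, hsamp⟩ := h
  -- The sampling and Riesz lower bounds together give the constant `A * A'`; half of it is
  -- contradictory.
  obtain ⟨F, hFpos, hFle⟩ := exists_symbolOp_small (pnsSymbol φ hρ x) y hdet
    (ε := A * A' / 2) (by positivity)
  obtain ⟨d, hd, hF⟩ := exists_sequence_of_residue_functions F
  obtain ⟨hsum, hlow, -⟩ := hRiesz d hd
  obtain ⟨g, hg, -, hAg, -⟩ := hsamp _ ⟨d, hd, hsum.hasSum⟩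
  obtain rfl := hg.unique (isRegularRep_shiftSeries hA hd hsum.hasSum)
  have hS := hasSum_sq_samples hρ x hA hd hF
  choose n l hnl using fun y : pnsSet (ρ : ℝ) x => y.2
  -- Points may still coincide, but choosing one parameter per point bounds the sum over the set by
  -- the sum over parameters, which is the direction needed.
  have hinj : Function.Injective fun y : pnsSet (ρ : ℝ) x => (n y, l y) := fun y z hyz => by
    have h1 := congrArg Prod.fst hyz
    have h2 := congrArg Prod.snd hyz
    simp only at h1 h2
    exact Subtype.ext (by rw [hnl y, hnl z, h1, h2])
  have hle := tsum_comp_le_tsum_of_inj hS.summable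
    (fun q => Finset.sum_nonneg fun _ _ => by positivity) hinj
  simp only [Function.comp_def, ← hnl] at hle
  rw [hS.tsum_eq] at hle
  rw [← sum_sq_norm_eq_tsum hd hF] at hlow
  have := mul_le_mul_of_nonneg_left hlow hApos.le
  nlinarith [mul_pos (mul_pos hApos hA') hFpos]

/-- The parametrisation of the sampling set by `Fin L × ℤ` when the points are distinct. -/
def pnsEquiv (hinj : Function.Injective fun q : Fin L × ℤ => x q.1 + (ρ : ℝ) * q.2) :
    Fin L × ℤ ≃ pnsSet (ρ : ℝ) x :=
  Equiv.ofBijective (fun q => ⟨x q.1 + ρ * q.2, q.1, q.2, rfl⟩)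
    ⟨fun _ _ h => hinj (congrArg Subtype.val h), fun ⟨_, n, l, h⟩ => ⟨(n, l), Subtype.ext h.symm⟩⟩

/-- The left inverse recovers `F` from the samples, giving the lower bound; boundedness of the
symbol itself gives the upper one. -/
lemma isStableSampling_of_isUnit (hA : ClassA (m + 1) φ) (hstable : IsStableGenerator φ hφ)
    (hu : IsUnit (pnsSymbol φ hρ x))
    (hinj : Function.Injective fun q : Fin L × ℤ => x q.1 + (ρ : ℝ) * q.2) :
    IsStableSampling φ hφ m (pnsSet (ρ : ℝ) x) := by
  obtain ⟨Ψ, -, hΨ⟩ := isUnit_iff_exists.1 hu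
  obtain ⟨-, A', B', hA', hB', hRiesz⟩ := hstable
  obtain ⟨B₁, hB₁, hΦb⟩ := exists_symbolOp_bound (pnsSymbol φ hρ x)
  obtain ⟨B₂, hB₂, hΨb⟩ := exists_symbolOp_bound Ψ
  refine ⟨(B' * B₂)⁻¹, B₁ / A', by positivity, by positivity, ?_⟩
  rintro f ⟨d, hd, hf⟩
  obtain ⟨F, hF⟩ := exists_residue_functions (ρ := ρ) hd
  have hS := hasSum_sq_samples hρ x hA hd hF
  have hS' := (pnsEquiv x hinj).hasSum_iff (f := fun y : pnsSet (ρ : ℝ) x =>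
    ∑ i ∈ Finset.range (m + 1), ‖iteratedDeriv i (shiftSeries d φ) y‖ ^ 2) |>.1 hS
  obtain ⟨-, hlow, hup⟩ := hRiesz d hd
  rw [hf.tsum_eq, ← sum_sq_norm_eq_tsum hd hF] at hlow hup
  refine ⟨_, isRegularRep_shiftSeries hA hd hf, hS'.summable, ?_, ?_⟩
  · rw [hS'.tsum_eq, inv_mul_le_iff₀ (by positivity)]
    have h1 := hΨb (symbolOp (pnsSymbol φ hρ x) F)
    rw [← symbolOp_mul, hΨ, symbolOp_one] at h1
    calc ‖f‖ ^ 2 ≤ B' * ∑ s, ‖F s‖ ^ 2 := hup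
      _ ≤ B' * (B₂ * _) := mul_le_mul_of_nonneg_left h1 hB'.le
      _ = _ := by ring
  · rw [hS'.tsum_eq, div_mul_eq_mul_div, le_div_iff₀ hA']
    calc _ ≤ B₁ * (∑ s, ‖F s‖ ^ 2) * A' := mul_le_mul_of_nonneg_right (hΦb F) hA'.le
      _ = B₁ * (A' * ∑ s, ‖F s‖ ^ 2) := by ring
      _ ≤ _ := mul_le_mul_of_nonneg_left hlow hB₁.le

/-- Prescribed data are the Fourier coefficients of a vector `G'`; the right inverse applied to it
supplies the coefficients of the interpolant. -/
lemma isInterpolationSet_of_isUnit (hA : ClassA (m + 1) φ) (hstable : IsStableGenerator φ hφ)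
    (hu : IsUnit (pnsSymbol φ hρ x))
    (hinj : Function.Injective fun q : Fin L × ℤ => x q.1 + (ρ : ℝ) * q.2) :
    IsInterpolationSet φ hφ m (pnsSet (ρ : ℝ) x) := by
  intro c hc
  obtain ⟨Ψ, hΨ, -⟩ := isUnit_iff_exists.1 hu
  obtain ⟨-, A', B', hA', hB', hRiesz⟩ := hstable
  have hcs : ∀ q : Fin L × Fin (m + 1),
      Summable fun l : ℤ => ‖c (pnsEquiv x hinj (q.1, l)) q.2‖ ^ 2 := fun q => by
    have h1 : Summable fun l : ℤ => ∑ i, ‖c (pnsEquiv x hinj (q.1, l)) i‖ ^ 2 :=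
      hc.comp_injective ((pnsEquiv x hinj).injective.comp (Prod.mk_right_injective q.1))
    exact h1.of_nonneg_of_le (fun _ => by positivity) fun l =>
      Finset.single_le_sum (f := fun i => ‖c (pnsEquiv x hinj (q.1, l)) i‖ ^ 2)
        (fun _ _ => by positivity) (Finset.mem_univ q.2)
  choose G hG using fun q => exists_fourierCoeff_eq (hcs q)
  let G' : Fin ρ → L2Circle := fun i => G (finProdFinEquiv.symm (Fin.cast hρ i))
  obtain ⟨d, hd, hF⟩ := exists_sequence_of_residue_functions (symbolOp Ψ G')
  have hf := (hRiesz d hd).1.hasSum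
  refine ⟨_, ⟨d, hd, hf⟩, _, isRegularRep_shiftSeries hA hd hf, fun y i => ?_⟩
  obtain ⟨⟨n, l⟩, rfl⟩ := (pnsEquiv x hinj).surjective y
  have h1 := fourierCoeff_pnsSymbol hρ x hA hd hF n i l
  rw [← symbolOp_mul, hΨ, symbolOp_one] at h1
  refine h1.symm.trans ?_
  simp only [G', Fin.cast_cast, Fin.cast_eq_self, Equiv.symm_apply_apply, hG]

end

end

theorem mainTheorem2 (L r ρ : ℕ) (hL : 0 < L) (hr : 0 < r) (hρ : ρ = L * r)
    (φ : ℝ → ℂ) (hφ : MemLp φ 2 volume) (hA : ClassA r φ) (hstable : IsStableGenerator φ hφ)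
    (x : Fin L → ℝ) :
    IsCIS φ hφ (r - 1) (pnsSet (ρ : ℝ) x) ↔
      ∀ y ∈ Set.Icc (0 : ℝ) 1, (zakMatrix φ hρ x y).det ≠ 0 := by
  obtain ⟨m, rfl⟩ := Nat.exists_eq_add_one.2 hr
  have : NeZero ρ := ⟨by rw [hρ]; positivity⟩
  rw [Nat.add_sub_cancel, forall_det_zakMatrix_ne_zero_iff hρ x hA]
  refine ⟨fun h => det_pnsSymbol_ne_zero_of_isStableSampling hρ x hA hstable h.1, fun h => ?_⟩
  have hu := isUnit_matrix_of_det_ne_zero _ h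
  have hinj := pns_injective hρ x hA (h 0)
  exact ⟨isStableSampling_of_isUnit hρ x hA hstable hu hinj,
    isInterpolationSet_of_isUnit hρ x hA hstable hu hinj⟩
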